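/- Let $(\Omega,\mathcal F,\mathbb P)$ be a probability space, and for $p\in(0,1)$ let $\mathrm{VaR}_p(Y)=\inf\{x\in\mathbb R:\mathbb P(Y\le x)\ge p\}$. Let $(\mathcal Z,\pi)$ be one of: $L^\infty$ with the metric $\|Y-Z\|_\infty$; $L^r$ with the metric $\|Y-Z\|_r$, for some $r\in[1,\infty)$; the space $L^0$ of all real random variables with the Prokhorov pseudo-metric between distributions. Let $X\in\mathcal Z$ with $X\ge 0$ a.s., and let the distribution of $X$ have a Lebesgue density that is positive on its support. Let $\gamma$ be a measurable function that is continuous and strictly positive on $(0,\infty)$, write $\gamma$ also for the random variable $\gamma(X)$, and suppose $\mathbb E[\gamma]=1$ and $\mathbb E[\gamma X]<\infty$. For a set $\mathcal G$ of measurable functions $g:\mathbb R\to\mathbb R$ let $\mathrm{VaR}_p(X;\mathcal G)=\inf_{g\in\mathcal G}\mathrm{VaR}_p(g(X))\in[-\infty,\infty]$. We say that $\mathrm{VaR}_p$ is *robust at $X$ relative to $(\mathcal G,\mathcal Z,\pi)$* if there is $g\in\mathcal G$ with $\mathrm{VaR}_p(g(X))=\mathrm{VaR}_p(X;\mathcal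 G)$ for which the map $\mathcal Z\ni Y\mapsto \mathrm{VaR}_p(g(Y))$ is $\pi$-continuous at $Y=X$. (In all cases below $\mathrm{VaR}_p$ is compatible with $(\mathcal G,\mathcal Z,\pi)$: it is real-valued on $\{g(Z):g\in\mathcal G,\,Z\in\mathcal Z\}$, and $\mathrm{VaR}_p(g(Y))=\mathrm{VaR}_p(g(Z))$ whenever $g\in\mathcal G$, $Y,Z\in\mathcal Z$ and $\pi(Y,Z)=0$.) For $p\in(0,1)$ the following hold. (i) For every $x_0\in\mathbb R$, $\mathrm{VaR}_p$ is not robust at $X$ relative to $(\mathcal G_{\rm cm},\mathcal Z,\pi)$, where $\mathcal G_{\rm cm}$ is the set of measurable $g$ with $\gamma g(X)$ integrable and $\mathbb E[\gamma g(X)]\ge x_0$. In (ii) and (iii) assume in addition, if $\pi$ is the $L^\infty$-metric, that the support of $X$ is an interval. (ii) Let $0\le x_0<\mathbb E[\gamma X]$ and $\mathcal G_{\rm ns}=\{g\in\mathcal G_{\rm cm}:0\le g(X)\le X\text{ a.s.}\}$. If $q=\mathrm{VaR}_p(X;\mathcal G_{\rm ns})$ satisfies $q>0$ and $\mathbb P\big((X-q)\gamma\le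 \mathrm{VaR}_p((X-q)\gamma)\big)=p$, then $\mathrm{VaR}_p$ is not robust at $X$ relative to $(\mathcal G_{\rm ns},\mathcal Z,\pi)$. (iii) Let $0\le x_0<m$ and $\mathcal G_{\rm bd}=\{g\in\mathcal G_{\rm cm}:0\le g(X)\le m\text{ a.s.}\}$. If $\mathrm{VaR}_p(X;\mathcal G_{\rm bd})>0$ and $\mathbb P(\gamma\le\mathrm{VaR}_p(\gamma))=p$, then $\mathrm{VaR}_p$ is not robust at $X$ relative to $(\mathcal G_{\rm bd},\mathcal Z,\pi)$. -/

import Mathlib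

open MeasureTheory Set Filter Topology
open scoped ENNReal

namespace RobustOpt

section General

variable {Ω E : Type*}

/-- The minimum possible value `ρ(X; 𝒢) = inf {ρ(g(X)) : g ∈ 𝒢}`, an extended real number. -/
noncomputable def optimalValue (ρ : (Ω → ℝ) → EReal) (𝒢 : Set (E → ℝ)) (X : Ω → E) : EReal :=
  sInf ((fun g : E → ℝ => ρ (fun ω => g (X ω))) '' 𝒢)

/-- The set `𝒢_X(ρ)` of optimizing functions. -/
def optimizers (ρ : (Ω → ℝ) → EReal) (𝒢 : Set (E → ℝ)) (X : Ω → E) : Set (E → ℝ) :=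
  {g | g ∈ 𝒢 ∧ ρ (fun ω => g (X ω)) = optimalValue ρ 𝒢 X}

/-- `ρ` is a compatible objective functional for the uncertainty triplet `(𝒢, 𝒵, π)`: on
`{g(Z) : g ∈ 𝒢, Z ∈ 𝒵}` it takes values in `ℝ ∪ {+∞}`, and it does not distinguish between
`g(Y)` and `g(Z)` when `π(Y, Z) = 0`. -/
def IsCompatible (ρ : (Ω → ℝ) → EReal) (𝒢 : Set (E → ℝ)) (𝒵 : Set (Ω → E))
    (π : (Ω → E) → (Ω → E) → ℝ) : Prop :=
  (∀ g ∈ 𝒢, ∀ Z ∈ 𝒵, ρ (fun ω => g (Z ω)) ≠ ⊥) ∧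
  ∀ g ∈ 𝒢, ∀ Y ∈ 𝒵, ∀ Z ∈ 𝒵, π Y Z = 0 → ρ (fun ω => g (Y ω)) = ρ (fun ω => g (Z ω))

/-- `ρ` is robust at `X` relative to `(𝒢, 𝒵, π)`: for some optimizing function `g`, the map
`𝒵 → ℝ ∪ {+∞}`, `Y ↦ ρ(g(Y))`, is `π`-continuous at `Y = X`. -/
def IsRobust (ρ : (Ω → ℝ) → EReal) (𝒢 : Set (E → ℝ)) (𝒵 : Set (Ω → E))
    (π : (Ω → E) → (Ω → E) → ℝ) (X : Ω → E) : Prop :=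
  ∃ g ∈ optimizers ρ 𝒢 X, ∀ U ∈ 𝓝 (ρ (fun ω => g (X ω))),
    ∃ δ > 0, ∀ Y ∈ 𝒵, π X Y < δ → ρ (fun ω => g (Y ω)) ∈ U

end General

/-- The choices of the uncertainty `(𝒵, π)`: `L^∞` with the `L^∞`-metric, `L^q`
(`1 ≤ q < ∞`) with the `L^q`-metric, and `L^0` with the Prokhorov pseudo-metric. -/
inductive Uncertainty where
  | linf : Uncertainty
  | lq (q : ℝ) (hq : 1 ≤ q) : Uncertainty
  | weak : Uncertainty

section OneDim

variable {Ω : Type*} [MeasurableSpace Ω]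

/-- The set `𝒵` of random variables. -/
def Uncertainty.space (P : Measure Ω) : Uncertainty → Set (Ω → ℝ)
  | .linf => {Z | Measurable Z ∧ MemLp Z ∞ P}
  | .lq q _ => {Z | Measurable Z ∧ MemLp Z (ENNReal.ofReal q) P}
  | .weak => {Z | Measurable Z}

/-- The pseudo-metric `π` on `𝒵`. -/
noncomputable def Uncertainty.dist (P : Measure Ω) : Uncertainty → (Ω → ℝ) → (Ω → ℝ) → ℝ
  | .linf => fun Y Z => (eLpNorm (fun ω => Y ω - Z ω) ∞ P).toReal
  | .lq q _ => fun Y Z => (eLpNorm (fun ω => Y ω - Z ω) (ENNReal.ofReal q) P).toReal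
  | .weak => fun Y Z => levyProkhorovDist (P.map Y) (P.map Z)

/-- Value-at-Risk: `VaR_p(Y) = inf {x ∈ ℝ : P(Y ≤ x) ≥ p}`. -/
noncomputable def VaR (P : Measure Ω) (p : ℝ) (Y : Ω → ℝ) : ℝ :=
  sInf {x : ℝ | ENNReal.ofReal p ≤ P {ω | Y ω ≤ x}}

/-- `VaR_p` as an objective functional. -/
noncomputable def VaRObj (P : Measure Ω) (p : ℝ) (Y : Ω → ℝ) : EReal := (VaR P p Y : EReal)

/-- The complete-market admissible set: `E[γ g(X)] ≥ x₀`. -/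
def Gcm (P : Measure Ω) (X : Ω → ℝ) (γ : ℝ → ℝ) (x₀ : ℝ) : Set (ℝ → ℝ) :=
  {g | Measurable g ∧ Integrable (fun ω => γ (X ω) * g (X ω)) P ∧
    x₀ ≤ ∫ ω, γ (X ω) * g (X ω) ∂P}

/-- The no-short-selling admissible set: `E[γ g(X)] ≥ x₀` and `0 ≤ g(X) ≤ X` a.s. -/
def Gns (P : Measure Ω) (X : Ω → ℝ) (γ : ℝ → ℝ) (x₀ : ℝ) : Set (ℝ → ℝ) :=
  {g | g ∈ Gcm P X γ x₀ ∧ ∀ᵐ ω ∂P, 0 ≤ g (X ω) ∧ g (X ω) ≤ X ω}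

/-- The bounded admissible set: `E[γ g(X)] ≥ x₀` and `0 ≤ g(X) ≤ m` a.s. -/
def Gbd (P : Measure Ω) (X : Ω → ℝ) (γ : ℝ → ℝ) (x₀ m : ℝ) : Set (ℝ → ℝ) :=
  {g | g ∈ Gcm P X γ x₀ ∧ ∀ᵐ ω ∂P, 0 ≤ g (X ω) ∧ g (X ω) ≤ m}

/-- The standing assumptions on the random loss `X` and the pricing density `γ = γ(X)`. Since
`X ≥ 0` has a density, `X > 0` a.s., so `γ` matters only on `(0, ∞)`. -/
structure StandingAssumptions (P : Measure Ω) (u : Uncertainty) (X : Ω → ℝ) (γ : ℝ → ℝ) :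
    Prop where
  mem : X ∈ u.space P
  nonneg : ∀ᵐ ω ∂P, 0 ≤ X ω
  density : ∃ f : ℝ → ℝ≥0∞, Measurable f ∧ P.map X = volume.withDensity f ∧
    ∀ x ∈ (P.map X).support, 0 < f x
  measurable_pricing : Measurable γ
  continuous_pricing : ContinuousOn γ (Ioi 0)
  pricing_pos : ∀ x > 0, 0 < γ x
  integrable_pricing : Integrable (fun ω => γ (X ω)) P
  expect_pricing : ∫ ω, γ (X ω) ∂P = 1
  integrable_price : Integrable (fun ω => γ (X ω) * X ω) P

/-- If the `L^∞`-metric is used, the support of `X` is an interval. -/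
def NoGap (P : Measure Ω) (u : Uncertainty) (X : Ω → ℝ) : Prop :=
  u = .linf → (P.map X).support.OrdConnected

/-- `q = VaR_p(X; 𝒢_ns) > 0` and `P((X - q)γ ≤ VaR_p((X - q)γ)) = p`. -/
def AssumptionV1 (P : Measure Ω) (p : ℝ) (X : Ω → ℝ) (γ : ℝ → ℝ) (x₀ : ℝ) : Prop :=
  ∃ q : ℝ, (q : EReal) = optimalValue (VaRObj P p) (Gns P X γ x₀) X ∧ 0 < q ∧
    P {ω | (X ω - q) * γ (X ω) ≤ VaR P p (fun ω' => (X ω' - q) * γ (X ω'))} = ENNReal.ofReal p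

/-- `q' = VaR_p(X; 𝒢_bd) > 0` and `P(γ ≤ VaR_p(γ)) = p`. -/
def AssumptionV2 (P : Measure Ω) (p : ℝ) (X : Ω → ℝ) (γ : ℝ → ℝ) (x₀ m : ℝ) : Prop :=
  0 < optimalValue (VaRObj P p) (Gbd P X γ x₀ m) X ∧
    P {ω | γ (X ω) ≤ VaR P p (fun ω' => γ (X ω'))} = ENNReal.ofReal p

end OneDim

end RobustOpt

namespace RobustOpt

/-! ### Basic properties of Value-at-Risk -/

section ValueAtRisk

variable {Ω : Type*} [MeasurableSpace Ω] {P : Measure Ω} {p : ℝ}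
  {Y Z : Ω → ℝ}

/-! In the complete market, a huge payoff on an event of small positive probability finances an
arbitrarily negative payoff elsewhere. The infimum is therefore -∞, while Value-at-Risk is real, so
there is no optimizer (`exists_mem_Gcm_VaR_le`).

The two constrained problems are one problem with gains capped by `U(X)`, where `U x = x` or `U =
m`. Let `q > 0` be the optimal value. Capping the gains at `q` on a `p`-event `B` and paying `U`
elsewhere cannot leave spare budget, since otherwise the level `q` could be lowered
(`exists_mem_Gcap_VaR_lt`). The cheapest choice is `B = {γ (U - q)⁺ ≤ v}`, with `v` a threshold at
which `B` has probability exactly `p`. A Neyman-Pearson comparison then forces every optimizer to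
equal `U` a.s. off `B` (`ae_eq_cap_of_tight`), where `U` exceeds some `b > q`.

So an optimizer jumps from level `q` to above `b` exactly at probability `p`. Moving a little mass
of `X` from `B` to a point outside `B` makes the probability of a gain at most `b` smaller than `p`,
and Value-at-Risk jumps above `b` (`exists_perturbation_le_VaR`). For `L^r` and the Prokhorov metric
a set of small mass can be moved far at small cost. For `L^∞` the displacement itself must be small,
and an interval support ensures that `B` and its complement both carry mass near a common point. -/

lemma VaR_congr_map (hY : Measurable Y) (hZ : Measurable Z) (h : P.map Y = P.map Z) :
    VaR P p Y = VaR P p Z := by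
  unfold VaR
  congr 1
  ext x
  have h1 : P {ω | Y ω ≤ x} = P.map Y (Iic x) := (Measure.map_apply hY measurableSet_Iic).symm
  have h2 : P {ω | Z ω ≤ x} = P.map Z (Iic x) := (Measure.map_apply hZ measurableSet_Iic).symm
  rw [mem_ofPred_eq, mem_ofPred_eq, h1, h2, h]

variable [IsProbabilityMeasure P]

lemma bddBelow_VaR (hY : Measurable Y) (hp : 0 < p) :
    BddBelow {x : ℝ | ENNReal.ofReal p ≤ P {ω | Y ω ≤ x}} := by
  have h0 : Tendsto (fun n : ℕ => P {ω | Y ω ≤ -(n : ℝ)}) atTop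
      (𝓝 (P (⋂ n : ℕ, {ω | Y ω ≤ -(n : ℝ)}))) := by
    refine tendsto_measure_iInter_atTop
      (fun n => (measurableSet_le hY measurable_const).nullMeasurableSet) ?_ ⟨0, measure_ne_top _ _⟩
    intro a b hab ω hω
    simp only [mem_ofPred_eq] at *
    have : (a : ℝ) ≤ b := by exact_mod_cast hab
    linarith
  have he : (⋂ n : ℕ, {ω | Y ω ≤ -(n : ℝ)}) = ∅ := by
    ext ω
    simp only [mem_iInter, mem_ofPred_eq, mem_empty_iff_false, iff_false, not_forall, not_le]
    obtain ⟨n, hn⟩ := exists_nat_gt (-Y ω)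
    exact ⟨n, by linarith⟩
  rw [he, measure_empty] at h0
  obtain ⟨n, hn⟩ := (h0.eventually_lt_const (ENNReal.ofReal_pos.2 hp)).exists
  refine ⟨-(n : ℝ), fun x hx => ?_⟩
  by_contra! hlt
  exact absurd (hx.trans (measure_mono fun ω (hω : Y ω ≤ x) => hω.trans hlt.le)) (not_le.2 hn)

lemma nonempty_VaR (hp : p < 1) :
    {x : ℝ | ENNReal.ofReal p ≤ P {ω | Y ω ≤ x}}.Nonempty := by
  have h0 : Tendsto (fun n : ℕ => P {ω | Y ω ≤ (n : ℝ)}) atTop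
      (𝓝 (P (⋃ n : ℕ, {ω | Y ω ≤ (n : ℝ)}))) := by
    refine tendsto_measure_iUnion_atTop ?_
    intro a b hab ω hω
    simp only [mem_ofPred_eq] at *
    have : (a : ℝ) ≤ b := by exact_mod_cast hab
    linarith
  have he : (⋃ n : ℕ, {ω | Y ω ≤ (n : ℝ)}) = univ := by
    ext ω
    simpa using exists_nat_ge (Y ω)
  rw [he, measure_univ] at h0
  have hp' : ENNReal.ofReal p < 1 := by
    rw [← ENNReal.ofReal_one]
    exact (ENNReal.ofReal_lt_ofReal_iff one_pos).2 hp
  obtain ⟨n, hn⟩ := (h0.eventually_const_lt hp').exists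
  exact ⟨n, hn.le⟩

lemma VaR_le (hY : Measurable Y) (hp : 0 < p) {x : ℝ} (hx : ENNReal.ofReal p ≤ P {ω | Y ω ≤ x}) :
    VaR P p Y ≤ x :=
  csInf_le (bddBelow_VaR hY hp) hx

/-- The infimum defining the Value-at-Risk is attained. -/
lemma ofReal_le_measure_le_VaR (hY : Measurable Y) (hp1 : p < 1) :
    ENNReal.ofReal p ≤ P {ω | Y ω ≤ VaR P p Y} := by
  set v := VaR P p Y with hv
  have h0 : Tendsto (fun n : ℕ => P {ω | Y ω ≤ v + 1 / ((n : ℝ) + 1)}) atTop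
      (𝓝 (P (⋂ n : ℕ, {ω | Y ω ≤ v + 1 / ((n : ℝ) + 1)}))) := by
    refine tendsto_measure_iInter_atTop
      (fun n => (measurableSet_le hY measurable_const).nullMeasurableSet) ?_ ⟨0, measure_ne_top _ _⟩
    intro a b hab ω hω
    simp only [mem_ofPred_eq] at *
    have := Nat.one_div_le_one_div (α := ℝ) hab
    linarith
  have he : (⋂ n : ℕ, {ω | Y ω ≤ v + 1 / ((n : ℝ) + 1)}) = {ω | Y ω ≤ v} := by
    ext ω
    simp only [mem_iInter, mem_ofPred_eq]
    constructor
    · intro h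
      refine le_of_forall_pos_le_add fun ε hε => ?_
      obtain ⟨n, hn⟩ := exists_nat_one_div_lt hε
      linarith [h n]
    · intro h n
      have : (0 : ℝ) < 1 / ((n : ℝ) + 1) := by positivity
      linarith
  rw [he] at h0
  refine ge_of_tendsto' h0 fun n => ?_
  have hpos : (0 : ℝ) < 1 / ((n : ℝ) + 1) := by positivity
  obtain ⟨x, hx, hxlt⟩ := exists_lt_of_csInf_lt (nonempty_VaR (P := P) (Y := Y) hp1)
    (show sInf {x : ℝ | ENNReal.ofReal p ≤ P {ω | Y ω ≤ x}} < v + 1 / ((n : ℝ) + 1) by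
      change VaR P p Y < _
      linarith)
  exact le_trans hx (measure_mono fun ω (hω : Y ω ≤ x) => hω.trans hxlt.le)

/-- The strict inequality relies on the infimum being attained. -/
lemma lt_VaR (hY : Measurable Y) (hp1 : p < 1) {x : ℝ}
    (hx : P {ω | Y ω ≤ x} < ENNReal.ofReal p) : x < VaR P p Y := by
  by_contra! h
  exact absurd ((ofReal_le_measure_le_VaR hY hp1).trans
    (measure_mono fun ω (hω : Y ω ≤ VaR P p Y) => hω.trans h)) (not_le.2 hx)

end ValueAtRisk

/-! ### The uncertainty metrics and compatibility -/

section Uncertainty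

variable {Ω : Type*} [MeasurableSpace Ω] {P : Measure Ω}

lemma Uncertainty.measurable_of_mem {u : Uncertainty} {Y : Ω → ℝ} (hY : Y ∈ u.space P) :
    Measurable Y := by
  cases u with
  | linf => exact hY.1
  | lq q hq => exact hY.1
  | weak => exact hY

variable [IsProbabilityMeasure P]

/-- Random variables at distance zero have the same distribution. -/
lemma Uncertainty.map_eq_of_dist_eq_zero {u : Uncertainty} {Y Z : Ω → ℝ} (hY : Y ∈ u.space P)
    (hZ : Z ∈ u.space P) (h : u.dist P Y Z = 0) : P.map Y = P.map Z := by
  have key : ∀ r : ℝ≥0∞, r ≠ 0 → MemLp Y r P → MemLp Z r P →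
      (eLpNorm (fun ω => Y ω - Z ω) r P).toReal = 0 → P.map Y = P.map Z := by
    intro r hr hY hZ h
    have hs : MemLp (fun ω => Y ω - Z ω) r P := hY.sub hZ
    rw [ENNReal.toReal_eq_zero_iff, or_iff_left hs.eLpNorm_ne_top,
      eLpNorm_eq_zero_iff hs.aestronglyMeasurable hr] at h
    refine Measure.map_congr ?_
    filter_upwards [h] with ω hω
    exact sub_eq_zero.1 hω
  cases u with
  | linf => exact key _ (by simp) hY.2 hZ.2 h
  | lq q hq => exact key _ (by simp; linarith) hY.2 hZ.2 h
  | weak =>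
    have hYm : Measurable Y := hY
    have hZm : Measurable Z := hZ
    have : IsProbabilityMeasure (P.map Y) := Measure.isProbabilityMeasure_map hYm.aemeasurable
    have : IsProbabilityMeasure (P.map Z) := Measure.isProbabilityMeasure_map hZm.aemeasurable
    have h0 : levyProkhorovEDist (P.map Y) (P.map Z) = 0 := by
      have h : (levyProkhorovEDist (P.map Y) (P.map Z)).toReal = 0 := h
      rwa [ENNReal.toReal_eq_zero_iff,
        or_iff_left (levyProkhorovEDist_ne_top _ _)] at h
    -- Prokhorov distance zero gives equality on closed sets only; these form a generating π-system.
    refine ext_of_generate_finite _ (borel_eq_generateFrom_isClosed (α := ℝ) ▸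
      BorelSpace.measurable_eq) isPiSystem_isClosed (fun s hs => ?_) (by simp)
    exact measure_eq_measure_of_levyProkhorovEDist_eq_zero_of_isClosed h0 hs
      ⟨1, one_pos, measure_ne_top _ _⟩ ⟨1, one_pos, measure_ne_top _ _⟩

lemma isCompatible_VaRObj {u : Uncertainty} {p : ℝ} {𝒢 : Set (ℝ → ℝ)}
    (h𝒢 : ∀ g ∈ 𝒢, Measurable g) :
    IsCompatible (VaRObj P p) 𝒢 (u.space P) (u.dist P) := by
  refine ⟨fun g _ Z _ => EReal.coe_ne_bot _, fun g hg Y hY Z hZ h => ?_⟩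
  have hYm := Uncertainty.measurable_of_mem hY
  have hZm := Uncertainty.measurable_of_mem hZ
  refine congrArg Real.toEReal (VaR_congr_map ((h𝒢 g hg).comp hYm) ((h𝒢 g hg).comp hZm) ?_)
  have := Uncertainty.map_eq_of_dist_eq_zero hY hZ h
  change P.map (g ∘ Y) = P.map (g ∘ Z)
  rw [← Measure.map_map (h𝒢 g hg) hYm, ← Measure.map_map (h𝒢 g hg) hZm, this]

end Uncertainty

end RobustOpt

namespace RobustOpt

/-! ### Small perturbations that transport mass out of a set -/

section Perturbation

/-- Around a point, small balls carry little mass of an atomless measure. -/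
lemma exists_ball_measure_lt {μ : Measure ℝ} [IsFiniteMeasure μ] [NullSingletonClass μ] (a : ℝ) {ε : ℝ≥0∞}
    (hε : 0 < ε) : ∃ δ > 0, δ ≤ 1 ∧ μ (Metric.ball a δ) < ε := by
  have h0 : Tendsto (fun n : ℕ => μ (Metric.ball a (1 / ((n : ℝ) + 1)))) atTop
      (𝓝 (μ (⋂ n : ℕ, Metric.ball a (1 / ((n : ℝ) + 1))))) := by
    refine tendsto_measure_iInter_atTop
      (fun n => Metric.isOpen_ball.measurableSet.nullMeasurableSet) ?_ ⟨0, measure_ne_top _ _⟩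
    exact fun i j hij => Metric.ball_subset_ball (Nat.one_div_le_one_div (α := ℝ) hij)
  have he : (⋂ n : ℕ, Metric.ball a (1 / ((n : ℝ) + 1))) ⊆ {a} := by
    intro x hx
    simp only [mem_iInter, Metric.mem_ball] at hx
    refine dist_le_zero.1 (le_of_forall_pos_le_add fun ε hε => ?_)
    obtain ⟨n, hn⟩ := exists_nat_one_div_lt hε
    linarith [hx n]
  rw [measure_mono_null he (measure_singleton a)] at h0
  obtain ⟨n, hn⟩ := (h0.eventually_lt_const hε).exists
  refine ⟨1 / ((n : ℝ) + 1), by positivity, ?_, hn⟩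
  rw [div_le_one (by positivity)]
  linarith [n.cast_nonneg (α := ℝ)]

/-- If the support of `μ` is an interval, then the supports of the restrictions of `μ` to a
non-null set and to its non-null complement meet. -/
lemma exists_mem_support_restrict_inter {μ : Measure ℝ} (hμ : μ.support.OrdConnected)
    {B : Set ℝ} (hB : MeasurableSet B) (h1 : μ B ≠ 0) (h2 : μ Bᶜ ≠ 0) :
    ∃ a, a ∈ (μ.restrict B).support ∧ a ∈ (μ.restrict Bᶜ).support := by
  have hpre : IsPreconnected μ.support := hμ.isPreconnected
  rw [isPreconnected_closed_iff] at hpre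
  have hsub1 : (μ.restrict B).support ⊆ μ.support := Measure.support_mono Measure.restrict_le_self
  have hsub2 : (μ.restrict Bᶜ).support ⊆ μ.support := Measure.support_mono Measure.restrict_le_self
  have hn1 : (μ.restrict B).support.Nonempty :=
    Measure.nonempty_support fun h => h1 (by simpa using Measure.restrict_eq_zero.1 h)
  have hn2 : (μ.restrict Bᶜ).support.Nonempty :=
    Measure.nonempty_support fun h => h2 (by simpa using Measure.restrict_eq_zero.1 h)
  -- The two restricted supports are nonempty closed sets covering the connected support of `μ`, so
  -- they cannot be disjoint.
  obtain ⟨a, -, ha⟩ := hpre _ _ Measure.isClosed_support Measure.isClosed_support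
    (by rw [← Measure.support_add, Measure.restrict_add_restrict_compl hB])
    (by rwa [inter_eq_right.2 hsub1]) (by rwa [inter_eq_right.2 hsub2])
  exact ⟨a, ha.1, ha.2⟩

variable {Ω : Type*} [MeasurableSpace Ω] {P : Measure Ω}

/-- Off `S` the variables agree, so each event changes its probability by at most `P S`; thickening
only helps. -/
lemma levyProkhorovDist_map_le {Y Z : Ω → ℝ} (hY : Measurable Y) (hZ : Measurable Z) {S : Set Ω}
    (hS : ∀ ω ∉ S, Y ω = Z ω) {δ : ℝ} (hδ : 0 ≤ δ) (h : P S ≤ ENNReal.ofReal δ) :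
    levyProkhorovDist (P.map Y) (P.map Z) ≤ δ := by
  have aux : ∀ Y' Z' : Ω → ℝ, Measurable Y' → Measurable Z' → (∀ ω ∉ S, Y' ω = Z' ω) →
      ∀ (ε : ℝ≥0∞) (B : Set ℝ), ENNReal.ofReal δ < ε → ε < ∞ → MeasurableSet B →
      P.map Y' B ≤ P.map Z' (Metric.thickening ε.toReal B) + ε := by
    intro Y' Z' hY' hZ' hS' ε B hε hε' hB
    have hpos : 0 < ε.toReal := ENNReal.toReal_pos (pos_of_gt hε).ne' hε'.ne
    rw [Measure.map_apply hY' hB, Measure.map_apply hZ' Metric.isOpen_thickening.measurableSet]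
    calc P (Y' ⁻¹' B) ≤ P ((Z' ⁻¹' Metric.thickening ε.toReal B) ∪ S) := by
          refine measure_mono fun ω hω => ?_
          by_cases hωS : ω ∈ S
          · exact Or.inr hωS
          · left
            rw [mem_preimage, ← hS' ω hωS]
            exact Metric.self_subset_thickening hpos _ hω
      _ ≤ _ := (measure_union_le _ _).trans (by gcongr; exact h.trans hε.le)
  have : levyProkhorovEDist (P.map Y) (P.map Z) ≤ ENNReal.ofReal δ :=
    levyProkhorovEDist_le_of_forall _ _ _ fun ε B h1 h2 h3 =>
      ⟨aux Y Z hY hZ hS ε B h1 h2 h3, aux Z Y hZ hY (fun ω hω => (hS ω hω).symm) ε B h1 h2 h3⟩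
  exact ENNReal.toReal_le_of_le_ofReal hδ this

variable [IsProbabilityMeasure P]

/-- A `π`-small perturbation of `X` moves a non-null part of `{X ∈ B}` to a point outside `B`. -/
lemma exists_perturbation {u : Uncertainty} {X : Ω → ℝ} (hX : X ∈ u.space P)
    [NullSingletonClass (P.map X)] (hgap : NoGap P u X) {B N : Set ℝ} (hB : MeasurableSet B)
    (h1 : P.map X B ≠ 0) (h2 : P.map X Bᶜ ≠ 0) (hN : ∀ᵐ x ∂P.map X, x ∈ N) {δ : ℝ}
    (hδ : 0 < δ) :
    ∃ A ⊆ B, MeasurableSet A ∧ P.map X A ≠ 0 ∧ ∃ y ∈ Bᶜ ∩ N, ∀ Y : Ω → ℝ, Measurable Y →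
      (∀ ω, X ω ∈ A → Y ω = y) → (∀ ω, X ω ∉ A → Y ω = X ω) →
      Y ∈ u.space P ∧ u.dist P X Y < δ := by
  have hXm := Uncertainty.measurable_of_mem hX
  have : IsProbabilityMeasure (P.map X) := Measure.isProbabilityMeasure_map hXm.aemeasurable
  have hmass : ∀ (D : Set ℝ) a r, a ∈ ((P.map X).restrict D).support → 0 < r →
      P.map X (D ∩ Metric.ball a r) ≠ 0 := by
    intro D a r ha hr
    have := (Measure.mem_support_iff_forall a).1 ha _ (Metric.ball_mem_nhds a hr)
    rw [Measure.restrict_apply Metric.isOpen_ball.measurableSet, inter_comm] at this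
    exact this.ne'
  have hpoint : ∀ D : Set ℝ, P.map X D ≠ 0 → (D ∩ N).Nonempty := by
    intro D hD
    by_contra! hcon
    refine hD (measure_mono_null (fun x hx => ?_) (ae_iff.1 hN))
    exact fun hxN => (hcon ▸ (⟨hx, hxN⟩ : x ∈ D ∩ N) : x ∈ (∅ : Set ℝ))
  have hmem : ∀ (r : ℝ≥0∞) {A : Set ℝ} {y C : ℝ} {Y : Ω → ℝ}, MemLp X r P → Measurable Y →
      (∀ ω, X ω ∈ A → Y ω = y) → (∀ ω, X ω ∉ A → Y ω = X ω) → (∀ x ∈ A, |x - y| ≤ C) → 0 ≤ C →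
      MemLp Y r P := by
    intro r A y C Y hXr hY hYA hYA' hC hC0
    have hd : MemLp (fun ω => X ω - Y ω) r P := by
      refine MemLp.of_bound (hXm.sub hY).aestronglyMeasurable C (Eventually.of_forall fun ω => ?_)
      by_cases hω : X ω ∈ A
      · rw [hYA ω hω, Real.norm_eq_abs]
        exact hC _ hω
      · rw [hYA' ω hω, sub_self, norm_zero]
        exact hC0
    have := hXr.sub hd
    refine this.ae_eq (Eventually.of_forall fun ω => ?_)
    simp
  have hloc : ∀ r : ℝ≥0∞, 1 ≤ r → r ≠ ∞ → MemLp X r P → ∃ A ⊆ B, MeasurableSet A ∧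
      P.map X A ≠ 0 ∧ ∃ y ∈ Bᶜ ∩ N, ∀ Y : Ω → ℝ, Measurable Y →
      (∀ ω, X ω ∈ A → Y ω = y) → (∀ ω, X ω ∉ A → Y ω = X ω) →
      MemLp Y r P ∧ (eLpNorm (fun ω => X ω - Y ω) r P).toReal < δ := by
    intro r hr1 hrtop hXr
    obtain ⟨y, hy⟩ := hpoint _ h2
    obtain ⟨a, ha⟩ : ((P.map X).restrict B).support.Nonempty :=
      Measure.nonempty_support fun h => h1 (by simpa using Measure.restrict_eq_zero.1 h)
    -- Bounds the displacement to `y` from any point of a ball around `a` of radius at most 1.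
    set C : ℝ := |a - y| + 1 with hCdef
    have hC0 : 0 < C := by positivity
    have hrpos : 0 < r.toReal := ENNReal.toReal_pos (one_pos.trans_le hr1).ne' hrtop
    -- The mass is chosen so that `C * mass ^ (1 / r)`, which bounds the `L^r`-distance, is at most
    -- `δ / 2`.
    obtain ⟨s, hs0, hs1, hs⟩ := exists_ball_measure_lt (μ := P.map X) a
      (ε := ENNReal.ofReal ((δ / (2 * C)) ^ r.toReal)) (ENNReal.ofReal_pos.2 (by positivity))
    have hbd : ∀ x ∈ B ∩ Metric.ball a s, |x - y| ≤ C := by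
      intro x hx
      have h3 : |x - a| < s := hx.2
      have h4 := abs_sub_le x a y
      linarith
    have hAm : MeasurableSet (B ∩ Metric.ball a s) := hB.inter Metric.isOpen_ball.measurableSet
    refine ⟨B ∩ Metric.ball a s, inter_subset_left, hAm, hmass _ _ _ ha hs0,
      y, hy, fun Y hY hYA hYA' => ⟨hmem r hXr hY hYA hYA' hbd hC0.le, ?_⟩⟩
    have hle : eLpNorm (fun ω => X ω - Y ω) r P ≤ ENNReal.ofReal (δ / 2) := by
      calc eLpNorm (fun ω => X ω - Y ω) r P
          ≤ eLpNorm ((X ⁻¹' (B ∩ Metric.ball a s)).indicator fun _ => C) r P := by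
            refine eLpNorm_mono fun ω => ?_
            by_cases hω : X ω ∈ B ∩ Metric.ball a s
            · rw [indicator_of_mem (show ω ∈ X ⁻¹' (B ∩ Metric.ball a s) from hω), hYA ω hω,
                Real.norm_eq_abs, Real.norm_of_nonneg hC0.le]
              exact hbd _ hω
            · rw [indicator_of_notMem (show ω ∉ X ⁻¹' (B ∩ Metric.ball a s) from hω), hYA' ω hω,
                sub_self]
        _ ≤ ‖C‖ₑ * P (X ⁻¹' (B ∩ Metric.ball a s)) ^ (1 / r.toReal) :=
            eLpNorm_indicator_const_le C r
        _ ≤ ‖C‖ₑ * ENNReal.ofReal ((δ / (2 * C)) ^ r.toReal) ^ (1 / r.toReal) := by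
            rw [← Measure.map_apply hXm hAm]
            gcongr
            exact (measure_mono inter_subset_right).trans hs.le
        _ = ENNReal.ofReal (δ / 2) := by
            rw [Real.enorm_of_nonneg hC0.le, ENNReal.ofReal_rpow_of_nonneg (by positivity)
              (by positivity), ← Real.rpow_mul (by positivity), mul_one_div_cancel hrpos.ne',
              Real.rpow_one, ← ENNReal.ofReal_mul hC0.le]
            congr 1
            field_simp
    linarith [ENNReal.toReal_le_of_le_ofReal (half_pos hδ).le hle]
  cases u with
  | linf =>
    -- Both the moved set and its target `y` are taken within `δ / 4` of a common support point, so
    -- the displacement is at most `δ / 2`.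
    obtain ⟨a, ha1, ha2⟩ := exists_mem_support_restrict_inter (hgap rfl) hB h1 h2
    obtain ⟨y, hy, hyN⟩ := hpoint _ (hmass _ a (δ / 4) ha2 (by positivity))
    have hbd : ∀ x ∈ B ∩ Metric.ball a (δ / 4), |x - y| ≤ δ / 2 := by
      intro x hx
      have h3 : |x - a| < δ / 4 := hx.2
      have h4 : |y - a| < δ / 4 := hy.2
      have h5 := abs_sub_le x a y
      rw [abs_sub_comm a y] at h5
      linarith
    refine ⟨B ∩ Metric.ball a (δ / 4), inter_subset_left,
      hB.inter Metric.isOpen_ball.measurableSet, hmass _ _ _ ha1 (by positivity), y,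
      ⟨hy.1, hyN⟩, fun Y hY hYA hYA' =>
        ⟨⟨hY, hmem _ hX.2 hY hYA hYA' hbd (by positivity)⟩, ?_⟩⟩
    have hle : eLpNorm (fun ω => X ω - Y ω) ∞ P ≤ ENNReal.ofReal (δ / 2) := by
      rw [eLpNorm_exponent_top]
      refine eLpNormEssSup_le_of_ae_bound (Eventually.of_forall fun ω => ?_)
      by_cases hω : X ω ∈ B ∩ Metric.ball a (δ / 4)
      · rw [hYA ω hω, Real.norm_eq_abs]
        exact hbd _ hω
      · rw [hYA' ω hω, sub_self, norm_zero]
        positivity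
    have hlt := ENNReal.toReal_le_of_le_ofReal (half_pos hδ).le hle
    change (eLpNorm (fun ω => X ω - Y ω) ∞ P).toReal < δ
    linarith
  | lq q hq =>
    obtain ⟨A, hAB, hA, hA0, y, hy, hY⟩ := hloc (ENNReal.ofReal q)
      (by rwa [← ENNReal.ofReal_one, ENNReal.ofReal_le_ofReal_iff (by linarith)])
      ENNReal.ofReal_ne_top hX.2
    refine ⟨A, hAB, hA, hA0, y, hy, fun Y hYm hYA hYA' => ?_⟩
    obtain ⟨h3, h4⟩ := hY Y hYm hYA hYA'
    exact ⟨⟨hYm, h3⟩, h4⟩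
  | weak =>
    obtain ⟨y, hy⟩ := hpoint _ h2
    obtain ⟨a, ha⟩ : ((P.map X).restrict B).support.Nonempty :=
      Measure.nonempty_support fun h => h1 (by simpa using Measure.restrict_eq_zero.1 h)
    obtain ⟨s, hs0, -, hs⟩ := exists_ball_measure_lt (μ := P.map X) a
      (ε := ENNReal.ofReal (δ / 2)) (ENNReal.ofReal_pos.2 (by positivity))
    have hAm : MeasurableSet (B ∩ Metric.ball a s) := hB.inter Metric.isOpen_ball.measurableSet
    refine ⟨B ∩ Metric.ball a s, inter_subset_left, hAm, hmass _ _ _ ha hs0,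
      y, hy, fun Y hY hYA hYA' => ⟨hY, ?_⟩⟩
    have := levyProkhorovDist_map_le (P := P) hXm hY (S := X ⁻¹' (B ∩ Metric.ball a s))
      (fun ω hω => (hYA' ω hω).symm) (half_pos hδ).le (by
        rw [← Measure.map_apply hXm hAm]
        exact (measure_mono inter_subset_right).trans hs.le)
    change levyProkhorovDist (P.map X) (P.map Y) < δ
    linarith

end Perturbation

end RobustOpt

/-! ### Jump of Value-at-Risk, and unboundedness in the complete market -/

namespace RobustOpt

variable {Ω : Type*} [MeasurableSpace Ω] {P : Measure Ω} [IsProbabilityMeasure P]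

/-- If the gains `g` jump over the interval `(q, q + c)` at the `p`-quantile, then
`Y ↦ VaR_p(g(Y))` is not continuous at `X`. -/
lemma exists_perturbation_le_VaR {u : Uncertainty} {X : Ω → ℝ} (hX : X ∈ u.space P)
    [NullSingletonClass (P.map X)] (hgap : NoGap P u X) {p : ℝ} (hp0 : 0 < p) (hp1 : p < 1)
    {g : ℝ → ℝ} (hg : Measurable g) {B : Set ℝ} (hB : MeasurableSet B)
    (hBp : P.map X B = ENNReal.ofReal p) {b : ℝ}
    (hgb : ∀ᵐ x ∂P.map X, x ∉ B → b < g x) {δ : ℝ} (hδ : 0 < δ) :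
    ∃ Y ∈ u.space P, u.dist P X Y < δ ∧ b < VaR P p (fun ω => g (Y ω)) := by
  classical
  have hXm := Uncertainty.measurable_of_mem hX
  have : IsProbabilityMeasure (P.map X) := Measure.isProbabilityMeasure_map hXm.aemeasurable
  have hBc : P.map X Bᶜ ≠ 0 := by
    rw [prob_compl_eq_one_sub hB, hBp]
    refine (tsub_pos_of_lt ?_).ne'
    rw [← ENNReal.ofReal_one]
    exact (ENNReal.ofReal_lt_ofReal_iff one_pos).2 hp1
  -- `Y` puts positive mass on the single point `y`, so the almost sure bound on `g` must hold at
  -- `y` itself; this is the role of `N`.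
  obtain ⟨A, hAB, hA, hA0, y, ⟨hyB, hyN⟩, hY⟩ := exists_perturbation hX hgap hB
    (by rw [hBp]; exact (ENNReal.ofReal_pos.2 hp0).ne') hBc
    (N := {x | x ∉ B → b < g x}) hgb hδ
  set φ : ℝ → ℝ := A.piecewise (fun _ => y) id with hφ
  have hφm : Measurable φ := Measurable.piecewise hA measurable_const measurable_id
  obtain ⟨hYs, hYd⟩ := hY (fun ω => φ (X ω)) (hφm.comp hXm)
    (fun ω hω => by simp [hφ, hω]) (fun ω hω => by simp [hφ, hω])
  refine ⟨_, hYs, hYd, lt_VaR (hg.comp (hφm.comp hXm)) hp1 ?_⟩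
  calc P {ω | g (φ (X ω)) ≤ b} = P.map X {x | g (φ x) ≤ b} :=
        (Measure.map_apply hXm (measurableSet_le (hg.comp hφm) measurable_const)).symm
    _ ≤ P.map X (B \ A) := by
        refine measure_mono_ae ?_
        filter_upwards [hgb] with x hx (hxle : g (φ x) ≤ b)
        by_cases hxA : x ∈ A
        · rw [hφ, piecewise_eq_of_mem _ _ _ hxA] at hxle
          exact absurd (hyN hyB) (not_lt.2 hxle)
        · rw [hφ, piecewise_eq_of_notMem _ _ _ hxA] at hxle
          refine ⟨?_, hxA⟩
          by_contra hxB
          exact absurd (hx hxB) (not_lt.2 hxle)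
    _ = P.map X B - P.map X A := measure_sdiff hAB hA.nullMeasurableSet (measure_ne_top _ _)
    _ < P.map X B := ENNReal.sub_lt_self (measure_ne_top _ _)
        (by rw [hBp]; exact (ENNReal.ofReal_pos.2 hp0).ne') hA0
    _ = ENNReal.ofReal p := hBp

/-- In the complete market, the Value-at-Risk of the gains is unbounded below. -/
lemma exists_mem_Gcm_VaR_le {X : Ω → ℝ} (hX : Measurable X) [NullSingletonClass (P.map X)] {γ : ℝ → ℝ}
    (hγ0 : ∀ᵐ ω ∂P, 0 < γ (X ω)) (hγi : Integrable (fun ω => γ (X ω)) P)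
    {p : ℝ} (hp0 : 0 < p) (hp1 : p < 1) (x₀ t : ℝ) :
    ∃ g ∈ Gcm P X γ x₀, VaR P p (fun ω => g (X ω)) ≤ t := by
  have : IsProbabilityMeasure (P.map X) := Measure.isProbabilityMeasure_map hX.aemeasurable
  obtain ⟨a, ha⟩ : (P.map X).support.Nonempty :=
    Measure.nonempty_support (IsProbabilityMeasure.ne_zero _)
  obtain ⟨s, hs0, -, hs⟩ := exists_ball_measure_lt (μ := P.map X) a
    (ε := ENNReal.ofReal (1 - p)) (ENNReal.ofReal_pos.2 (by linarith))
  set D := Metric.ball a s with hD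
  have hDm : MeasurableSet D := Metric.isOpen_ball.measurableSet
  have hDpos : P (X ⁻¹' D) ≠ 0 := by
    rw [← Measure.map_apply hX hDm]
    exact ((Measure.mem_support_iff_forall a).1 ha _ (Metric.ball_mem_nhds a hs0)).ne'
  set e := ∫ ω in X ⁻¹' D, γ (X ω) ∂P with he
  have hepos : 0 < e := by
    rw [he, setIntegral_pos_iff_support_of_nonneg_ae (ae_restrict_of_ae (hγ0.mono fun _ h => h.le))
      hγi.integrableOn]
    refine (pos_iff_ne_zero.2 hDpos).trans_le (measure_mono_ae ?_)
    filter_upwards [hγ0] with ω hω hωD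
    exact ⟨hω.ne', hωD⟩
  -- The extra payoff on `D` that makes the price of `t + M 1_D` exactly `x₀`.
  set M := (x₀ - t * ∫ ω, γ (X ω) ∂P) / e with hM
  have hint : ∀ ω, γ (X ω) * (t + D.indicator (fun _ => M) (X ω)) =
      t * γ (X ω) + M * (X ⁻¹' D).indicator (fun ω => γ (X ω)) ω := by
    intro ω
    by_cases hω : X ω ∈ D
    · rw [indicator_of_mem hω, indicator_of_mem (show ω ∈ X ⁻¹' D from hω)]
      ring
    · rw [indicator_of_notMem hω, indicator_of_notMem (show ω ∉ X ⁻¹' D from hω)]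
      ring
  have hi1 : Integrable (fun ω => t * γ (X ω)) P := hγi.const_mul t
  have hi2 : Integrable (fun ω => M * (X ⁻¹' D).indicator (fun ω => γ (X ω)) ω) P :=
    (hγi.indicator (hX hDm)).const_mul M
  have hgm : Measurable fun x : ℝ => t + D.indicator (fun _ => M) x :=
    measurable_const.add (measurable_const.indicator hDm)
  refine ⟨fun x => t + D.indicator (fun _ => M) x, ⟨hgm, ?_, ?_⟩, ?_⟩
  · simp_rw [hint]
    exact hi1.add hi2
  · simp_rw [hint]
    rw [integral_add hi1 hi2, integral_const_mul, integral_const_mul,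
      integral_indicator (hX hDm), ← he, hM, div_mul_cancel₀ _ hepos.ne']
    linarith
  · refine VaR_le (hgm.comp hX) hp0 ?_
    calc ENNReal.ofReal p = 1 - ENNReal.ofReal (1 - p) := by
          rw [← ENNReal.ofReal_one, ← ENNReal.ofReal_sub _ (by linarith)]
          congr 1
          ring
      _ ≤ 1 - P.map X D := by gcongr
      _ = P.map X Dᶜ := (prob_compl_eq_one_sub hDm).symm
      _ = P (X ⁻¹' Dᶜ) := Measure.map_apply hX hDm.compl
      _ ≤ _ := by
          refine measure_mono fun ω (hω : X ω ∉ D) => ?_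
          simp [hω]

end RobustOpt

/-! ### The common problem with gains capped by `U(X)` -/

namespace RobustOpt

variable {Ω : Type*} [MeasurableSpace Ω] {P : Measure Ω}

/-- The admissible set with gains capped by `U(X)`: `E[γ g(X)] ≥ x₀` and `0 ≤ g(X) ≤ U(X)` a.s. -/
def Gcap (P : Measure Ω) (X : Ω → ℝ) (γ : ℝ → ℝ) (x₀ : ℝ) (U : ℝ → ℝ) : Set (ℝ → ℝ) :=
  {g | g ∈ Gcm P X γ x₀ ∧ ∀ᵐ ω ∂P, 0 ≤ g (X ω) ∧ g (X ω) ≤ U (X ω)}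

lemma integrable_pricing_mul_of_le {X : Ω → ℝ} (hX : Measurable X) {γ U g : ℝ → ℝ}
    (hγ : Measurable γ) (hγ0 : ∀ᵐ ω ∂P, 0 < γ (X ω))
    (hγU : Integrable (fun ω => γ (X ω) * U (X ω)) P) (hg : Measurable g)
    (h : ∀ᵐ ω ∂P, 0 ≤ g (X ω) ∧ g (X ω) ≤ U (X ω)) :
    Integrable (fun ω => γ (X ω) * g (X ω)) P := by
  refine hγU.mono ((hγ.comp hX).mul (hg.comp hX)).aestronglyMeasurable ?_
  filter_upwards [hγ0, h] with ω h1 h2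
  rw [Real.norm_of_nonneg (mul_nonneg h1.le h2.1),
    Real.norm_of_nonneg (mul_nonneg h1.le (h2.1.trans h2.2))]
  exact mul_le_mul_of_nonneg_left h2.2 h1.le

lemma measurable_piecewise_min {U : ℝ → ℝ} (hU : Measurable U) {B : Set ℝ}
    (hB : MeasurableSet B) [DecidablePred (· ∈ B)] (t : ℝ) :
    Measurable (B.piecewise (fun x => min (U x) t) U) :=
  Measurable.piecewise hB (hU.min measurable_const) hU

lemma piecewise_min_mem_Icc {U : ℝ → ℝ} {B : Set ℝ} [DecidablePred (· ∈ B)] {t x : ℝ}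
    (ht : 0 ≤ t) (hx : 0 ≤ U x) :
    0 ≤ B.piecewise (fun x => min (U x) t) U x ∧ B.piecewise (fun x => min (U x) t) U x ≤ U x := by
  by_cases h : x ∈ B
  · rw [piecewise_eq_of_mem _ _ _ h]
    exact ⟨le_min hx ht, min_le_left _ _⟩
  · rw [piecewise_eq_of_notMem _ _ _ h]
    exact ⟨hx, le_rfl⟩

lemma optimalValue_le_of_mem {p : ℝ} {𝒢 : Set (ℝ → ℝ)} {X : Ω → ℝ} {g : ℝ → ℝ} (hg : g ∈ 𝒢) :
    optimalValue (VaRObj P p) 𝒢 X ≤ (VaR P p (fun ω => g (X ω)) : EReal) :=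
  sInf_le ⟨g, hg, rfl⟩

variable [IsProbabilityMeasure P]

/-- If capping the gains at `q` on a `p`-event leaves some budget, then a Value-at-Risk below `q`
is admissible. -/
lemma exists_mem_Gcap_VaR_lt {X : Ω → ℝ} (hX : Measurable X) {γ U : ℝ → ℝ}
    (hγ : Measurable γ) (hγ0 : ∀ᵐ ω ∂P, 0 < γ (X ω)) (hγi : Integrable (fun ω => γ (X ω)) P)
    (hγ1 : ∫ ω, γ (X ω) ∂P = 1) (hU : Measurable U) (hU0 : ∀ᵐ ω ∂P, 0 ≤ U (X ω))
    (hγU : Integrable (fun ω => γ (X ω) * U (X ω)) P) {p : ℝ} (hp0 : 0 < p) {q x₀ : ℝ}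
    (hq : 0 < q) {B : Set ℝ} [DecidablePred (· ∈ B)] (hB : MeasurableSet B)
    (hBp : ENNReal.ofReal p ≤ P.map X B)
    (hx₀ : x₀ < ∫ ω, γ (X ω) * B.piecewise (fun x => min (U x) q) U (X ω) ∂P) :
    ∃ g ∈ Gcap P X γ x₀ U, VaR P p (fun ω => g (X ω)) < q := by
  have hint : ∀ t : ℝ, 0 ≤ t →
      Integrable (fun ω => γ (X ω) * B.piecewise (fun x => min (U x) t) U (X ω)) P := fun t ht =>
    integrable_pricing_mul_of_le hX hγ hγ0 hγU (measurable_piecewise_min hU hB t)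
      (hU0.mono fun ω hω => piecewise_min_mem_Icc ht hω)
  set e := (∫ ω, γ (X ω) * B.piecewise (fun x => min (U x) q) U (X ω) ∂P) - x₀ with he
  -- Since `E[γ] = 1`, lowering the cap by at most `e` costs at most the slack `e`; the maximum with
  -- 0 keeps gains nonnegative.
  set t := max 0 (q - e) with ht
  have ht0 : 0 ≤ t := le_max_left _ _
  have htq : t < q := max_lt hq (by linarith)
  have hte : q - t ≤ e := by linarith [le_max_right 0 (q - e)]
  refine ⟨B.piecewise (fun x => min (U x) t) U,
    ⟨⟨measurable_piecewise_min hU hB t, hint t ht0, ?_⟩,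
      hU0.mono fun ω hω => piecewise_min_mem_Icc ht0 hω⟩, ?_⟩
  · have hle : (∫ ω, γ (X ω) * B.piecewise (fun x => min (U x) q) U (X ω) ∂P) -
        ∫ ω, (q - t) * γ (X ω) ∂P ≤
        ∫ ω, γ (X ω) * B.piecewise (fun x => min (U x) t) U (X ω) ∂P := by
      rw [← integral_sub (hint q hq.le) (hγi.const_mul _)]
      refine integral_mono_ae ((hint q hq.le).sub (hγi.const_mul _)) (hint t ht0) ?_
      filter_upwards [hγ0] with ω hω
      have : B.piecewise (fun x => min (U x) q) U (X ω) - (q - t) ≤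
          B.piecewise (fun x => min (U x) t) U (X ω) := by
        by_cases h : X ω ∈ B
        · rw [piecewise_eq_of_mem _ _ _ h, piecewise_eq_of_mem _ _ _ h]
          refine le_min ?_ ?_
          · linarith [min_le_left (U (X ω)) q]
          · linarith [min_le_right (U (X ω)) q]
        · rw [piecewise_eq_of_notMem _ _ _ h, piecewise_eq_of_notMem _ _ _ h]
          linarith
      have h2 := mul_le_mul_of_nonneg_left this hω.le
      linarith
    rw [integral_const_mul, hγ1] at hle
    linarith
  · refine (VaR_le ((measurable_piecewise_min hU hB t).comp hX) hp0 ?_).trans_lt htq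
    rw [Measure.map_apply hX hB] at hBp
    refine hBp.trans (measure_mono fun ω (hω : X ω ∈ B) => ?_)
    simp [hω]

/-- An admissible `g` whose Value-at-Risk is `q` attains the cap wherever capping it at `q` would
be too expensive. -/
lemma ae_eq_cap_of_tight {X : Ω → ℝ} (hX : Measurable X) {γ U g : ℝ → ℝ}
    (hγ : Measurable γ) (hγ0 : ∀ᵐ ω ∂P, 0 < γ (X ω)) (hU : Measurable U)
    (hU0 : ∀ᵐ ω ∂P, 0 ≤ U (X ω)) (hγU : Integrable (fun ω => γ (X ω) * U (X ω)) P)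
    {p q v x₀ : ℝ} (hp0 : 0 < p) (hq : 0 < q) (hv : 0 < v) {B : Set ℝ} [DecidablePred (· ∈ B)]
    (hB : ∀ x, x ∈ B ↔ γ x * max (U x - q) 0 ≤ v) (hBp : P.map X B = ENNReal.ofReal p)
    (hx₀ : ∫ ω, γ (X ω) * B.piecewise (fun x => min (U x) q) U (X ω) ∂P ≤ x₀)
    (hg : g ∈ Gcap P X γ x₀ U) (hgp : ENNReal.ofReal p ≤ P {ω | g (X ω) ≤ q}) :
    ∀ᵐ ω ∂P, X ω ∉ B → g (X ω) = U (X ω) := by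
  obtain ⟨⟨hgm, hgi, hgx⟩, hgU⟩ := hg
  have hBm : MeasurableSet B := by
    have : B = {x | γ x * max (U x - q) 0 ≤ v} := by
      ext x
      exact hB x
    rw [this]
    exact measurableSet_le (hγ.mul ((hU.sub_const q).max measurable_const)) measurable_const
  have hB'm : MeasurableSet (X ⁻¹' B) := hX hBm
  have hEm : MeasurableSet {ω | g (X ω) ≤ q} := measurableSet_le (hgm.comp hX) measurable_const
  set S := X ⁻¹' B with hS
  set E := {ω | g (X ω) ≤ q} with hE
  set f : Ω → ℝ := fun ω => γ (X ω) * B.piecewise (fun x => min (U x) q) U (X ω) with hf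
  have hfi : Integrable f P :=
    integrable_pricing_mul_of_le hX hγ hγ0 hγU (measurable_piecewise_min hU hBm q)
      (hU0.mono fun ω hω => piecewise_min_mem_Icc hq.le hω)
  have hiS : Integrable (S.indicator fun _ => v) P := (integrable_const v).indicator hB'm
  have hiE : Integrable (E.indicator fun _ => v) P := (integrable_const v).indicator hEm
  -- Lagrangian comparison of the capped strategy with `g`, at price `v` per unit of probability. It
  -- is nonnegative pointwise by the choice of `B`. Its integral is at most 0, because `E[f] ≤ x₀ ≤
  -- E[γ g]` and `P S = p ≤ P E`. Hence it vanishes a.s.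
  set ψ : Ω → ℝ := fun ω => (f ω - γ (X ω) * g (X ω)) +
    (S.indicator (fun _ => v) ω - E.indicator (fun _ => v) ω) with hψ
  have hψi : Integrable ψ P := (hfi.sub hgi).add (hiS.sub hiE)
  have hψ0 : 0 ≤ᵐ[P] ψ := by
    filter_upwards [hγ0, hgU] with ω h1 h2
    have hcap : q ≤ U (X ω) → X ω ∈ B → γ (X ω) * (U (X ω) - q) ≤ v := by
      intro h3 h4
      have := (hB _).1 h4
      rwa [max_eq_left (by linarith)] at this
    have hcap' : X ω ∉ B → v < γ (X ω) * (U (X ω) - q) := by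
      intro h4
      have h5 := not_le.1 (mt (hB _).2 h4)
      rcases le_total 0 (U (X ω) - q) with h6 | h6
      · rwa [max_eq_left h6] at h5
      · rw [max_eq_right h6] at h5
        linarith
    change 0 ≤ _
    simp only [hψ, hf]
    by_cases h3 : X ω ∈ B
    · rw [piecewise_eq_of_mem _ _ _ h3, indicator_of_mem (show ω ∈ S from h3)]
      by_cases h4 : g (X ω) ≤ q
      · rw [indicator_of_mem (show ω ∈ E from h4)]
        have := mul_le_mul_of_nonneg_left (le_min h2.2 h4) h1.le
        linarith
      · rw [indicator_of_notMem (show ω ∉ E from h4)]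
        have h5 : q ≤ U (X ω) := by linarith
        rw [min_eq_right h5]
        have := mul_le_mul_of_nonneg_left h2.2 h1.le
        linarith [hcap h5 h3]
    · rw [piecewise_eq_of_notMem _ _ _ h3, indicator_of_notMem (show ω ∉ S from h3)]
      by_cases h4 : g (X ω) ≤ q
      · rw [indicator_of_mem (show ω ∈ E from h4)]
        have := mul_le_mul_of_nonneg_left h4 h1.le
        linarith [hcap' h3]
      · rw [indicator_of_notMem (show ω ∉ E from h4)]
        have := mul_le_mul_of_nonneg_left h2.2 h1.le
        linarith
  have hψint : ∫ ω, ψ ω ∂P ≤ 0 := by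
    have e1 : ∫ ω, ψ ω ∂P = (∫ ω, f ω ∂P - ∫ ω, γ (X ω) * g (X ω) ∂P) +
        (∫ ω, S.indicator (fun _ => v) ω ∂P - ∫ ω, E.indicator (fun _ => v) ω ∂P) := by
      rw [← integral_sub hfi hgi, ← integral_sub hiS hiE]
      exact integral_add (hfi.sub hgi) (hiS.sub hiE)
    have e2 : P.real S = p := by
      rw [Measure.real, hS, ← Measure.map_apply hX hBm, hBp, ENNReal.toReal_ofReal hp0.le]
    have e3 : p ≤ P.real E := (ENNReal.ofReal_le_iff_le_toReal (measure_ne_top _ _)).1 hgp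
    rw [e1, integral_indicator_const _ hB'm, integral_indicator_const _ hEm, e2, smul_eq_mul,
      smul_eq_mul]
    have := mul_le_mul_of_nonneg_right e3 hv.le
    linarith
  have hψz : ψ =ᵐ[P] 0 := (integral_eq_zero_iff_of_nonneg_ae hψ0 hψi).1
    (le_antisymm hψint (integral_nonneg_of_ae hψ0))
  filter_upwards [hψz, hγ0, hgU] with ω h0 h1 h2 h3
  have h5 := not_le.1 (mt (hB _).2 h3)
  have h6 : v < γ (X ω) * (U (X ω) - q) := by
    rcases le_total 0 (U (X ω) - q) with h6 | h6
    · rwa [max_eq_left h6] at h5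
    · rw [max_eq_right h6] at h5
      linarith
  simp only [hψ, hf, Pi.zero_apply] at h0
  rw [piecewise_eq_of_notMem _ _ _ h3, indicator_of_notMem (show ω ∉ S from h3)] at h0
  -- Off `B`, a gain at most `q` would make `ψ` strictly positive, so `g > q` there, and then `ψ = γ
  -- (U - g)` must be zero.
  by_cases h4 : g (X ω) ≤ q
  · rw [indicator_of_mem (show ω ∈ E from h4)] at h0
    have := mul_le_mul_of_nonneg_left h4 h1.le
    linarith
  · rw [indicator_of_notMem (show ω ∉ E from h4)] at h0
    have : γ (X ω) * g (X ω) = γ (X ω) * U (X ω) := by linarith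
    exact mul_left_cancel₀ h1.ne' this

/-- Tightness of the budget at `q` forces any optimizer to exceed `b > q` a.s. off `B`; arbitrarily
small perturbations then lift Value-at-Risk above `b`. -/
theorem not_isRobust_Gcap {u : Uncertainty} {X : Ω → ℝ} (hX : X ∈ u.space P)
    [NullSingletonClass (P.map X)] (hgap : NoGap P u X) {γ U : ℝ → ℝ}
    (hγ : Measurable γ) (hγ0 : ∀ᵐ ω ∂P, 0 < γ (X ω)) (hγi : Integrable (fun ω => γ (X ω)) P)
    (hγ1 : ∫ ω, γ (X ω) ∂P = 1) (hU : Measurable U) (hU0 : ∀ᵐ ω ∂P, 0 ≤ U (X ω))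
    (hγU : Integrable (fun ω => γ (X ω) * U (X ω)) P) {p q v x₀ : ℝ} (hp0 : 0 < p) (hp1 : p < 1)
    (hq : 0 < q) (hqopt : (q : EReal) = optimalValue (VaRObj P p) (Gcap P X γ x₀ U) X)
    (hv : 0 < v) (hp : P {ω | γ (X ω) * max (U (X ω) - q) 0 ≤ v} = ENNReal.ofReal p)
    {b : ℝ} (hb : q < b) (hbU : ∀ᵐ ω ∂P, v < γ (X ω) * max (U (X ω) - q) 0 → b < U (X ω)) :
    ¬ IsRobust (VaRObj P p) (Gcap P X γ x₀ U) (u.space P) (u.dist P) X := by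
  classical
  rintro ⟨g, ⟨hg, hgopt⟩, hcont⟩
  have hXm := Uncertainty.measurable_of_mem hX
  set B := {x | γ x * max (U x - q) 0 ≤ v} with hB
  have hBm : MeasurableSet B :=
    measurableSet_le (hγ.mul ((hU.sub_const q).max measurable_const)) measurable_const
  have hBp : P.map X B = ENNReal.ofReal p := by
    rw [Measure.map_apply hXm hBm]
    exact hp
  have hgq : VaR P p (fun ω => g (X ω)) = q := by
    rw [← hqopt] at hgopt
    exact EReal.coe_injective hgopt
  have hgm : Measurable g := hg.1.1
  have htight : ∫ ω, γ (X ω) * B.piecewise (fun x => min (U x) q) U (X ω) ∂P ≤ x₀ := by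
    by_contra! hlt
    obtain ⟨g', hg', hlt'⟩ :=
      exists_mem_Gcap_VaR_lt hXm hγ hγ0 hγi hγ1 hU hU0 hγU hp0 hq hBm hBp.ge hlt
    have := optimalValue_le_of_mem (P := P) (p := p) (X := X) hg'
    rw [← hqopt, EReal.coe_le_coe_iff] at this
    linarith
  have hgp : ENNReal.ofReal p ≤ P {ω | g (X ω) ≤ q} := by
    rw [← hgq]
    exact ofReal_le_measure_le_VaR (hgm.comp hXm) hp1
  have hgU := ae_eq_cap_of_tight hXm hγ hγ0 hU hU0 hγU hp0 hq hv (fun x => Iff.rfl) hBp htight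
    hg hgp
  have hgb : ∀ᵐ x ∂P.map X, x ∉ B → b < g x := by
    have hm : MeasurableSet {x | x ∉ B → b < g x} := by
      have : {x | x ∉ B → b < g x} = B ∪ {x | b < g x} := by
        ext x
        by_cases h : x ∈ B <;> simp [h]
      rw [this]
      exact hBm.union (measurableSet_lt measurable_const hgm)
    rw [ae_map_iff hXm.aemeasurable hm]
    filter_upwards [hgU, hbU] with ω h1 h2 h3
    rw [h1 h3]
    exact h2 (not_le.1 h3)
  obtain ⟨δ, hδ, hY⟩ := hcont (Iio (b : EReal)) (Iio_mem_nhds (by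
    change ((VaR P p (fun ω => g (X ω)) : ℝ) : EReal) < b
    rw [hgq]
    exact_mod_cast hb))
  obtain ⟨Y, hYs, hYd, hYb⟩ := exists_perturbation_le_VaR hX hgap hp0 hp1 hgm hBm hBp hgb hδ
  have h4 : ((VaR P p (fun ω => g (Y ω)) : ℝ) : EReal) < b := hY Y hYs hYd
  rw [EReal.coe_lt_coe_iff] at h4
  linarith

end RobustOpt

namespace RobustOpt

/-! ### The three admissible sets -/

section Standing

variable {Ω : Type*} [MeasurableSpace Ω] {P : Measure Ω}
  {u : Uncertainty} {X : Ω → ℝ} {γ : ℝ → ℝ}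

lemma StandingAssumptions.measurable (hA : StandingAssumptions P u X γ) : Measurable X :=
  Uncertainty.measurable_of_mem hA.mem

/-- Absence of atoms gives small balls small mass and excludes `X = 0` up to a null set. -/
lemma StandingAssumptions.nullSingletonClass (hA : StandingAssumptions P u X γ) :
    NullSingletonClass (P.map X) := by
  obtain ⟨f, -, hf, -⟩ := hA.density
  refine ⟨fun x => ?_⟩
  rw [hf]
  exact withDensity_absolutelyContinuous _ _ (measure_singleton x)

lemma StandingAssumptions.ae_pos (hA : StandingAssumptions P u X γ) : ∀ᵐ ω ∂P, 0 < X ω := by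
  have := hA.nullSingletonClass
  have h0 : ∀ᵐ ω ∂P, X ω ≠ 0 := by
    rw [ae_iff]
    have := measure_singleton (μ := P.map X) (0 : ℝ)
    rw [Measure.map_apply hA.measurable (measurableSet_singleton 0)] at this
    convert this using 2
    ext ω
    simp
  filter_upwards [h0, hA.nonneg] with ω h1 h2
  exact lt_of_le_of_ne h2 h1.symm

lemma StandingAssumptions.ae_pricing_pos (hA : StandingAssumptions P u X γ) :
    ∀ᵐ ω ∂P, 0 < γ (X ω) := hA.ae_pos.mono fun _ hω => hA.pricing_pos _ hω

variable [IsProbabilityMeasure P]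

theorem not_isRobust_Gcm (hA : StandingAssumptions P u X γ) {p : ℝ} (hp0 : 0 < p) (hp1 : p < 1)
    (x₀ : ℝ) : ¬ IsRobust (VaRObj P p) (Gcm P X γ x₀) (u.space P) (u.dist P) X := by
  have := hA.nullSingletonClass
  rintro ⟨g, ⟨-, hgopt⟩, -⟩
  obtain ⟨g', hg', hle⟩ := exists_mem_Gcm_VaR_le hA.measurable hA.ae_pricing_pos
    hA.integrable_pricing hp0 hp1 x₀ (VaR P p (fun ω => g (X ω)) - 1)
  have h := optimalValue_le_of_mem (P := P) (p := p) (X := X) hg'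
  rw [← hgopt] at h
  have := EReal.coe_le_coe_iff.1 h
  linarith

theorem not_isRobust_Gns (hA : StandingAssumptions P u X γ) {p : ℝ} (hp0 : 0 < p) (hp1 : p < 1)
    {x₀ : ℝ} (hx₀ : x₀ < ∫ ω, γ (X ω) * X ω ∂P) (hgap : NoGap P u X)
    (hV : AssumptionV1 P p X γ x₀) :
    ¬ IsRobust (VaRObj P p) (Gns P X γ x₀) (u.space P) (u.dist P) X := by
  classical
  have := hA.nullSingletonClass
  obtain ⟨q, hqopt, hq, hp⟩ := hV
  set v := VaR P p (fun ω' => (X ω' - q) * γ (X ω')) with hvdef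
  -- If `{X ≤ q}` had probability at least `p`, capping at `q` there would change nothing: the price
  -- stays `E[γ X] > x₀`, and the slack would allow a value below `q`.
  have hXq : P {ω | X ω ≤ q} < ENNReal.ofReal p := by
    by_contra! hle
    obtain ⟨g, hg, hlt⟩ := exists_mem_Gcap_VaR_lt (U := id) (x₀ := x₀) hA.measurable
      hA.measurable_pricing hA.ae_pricing_pos hA.integrable_pricing hA.expect_pricing measurable_id
      hA.nonneg hA.integrable_price hp0 hq (B := Iic q) measurableSet_Iic
      (by rwa [Measure.map_apply hA.measurable measurableSet_Iic]) (by
        convert hx₀ using 5 with ω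
        by_cases h : X ω ≤ q <;> simp [h])
    have := optimalValue_le_of_mem (P := P) (p := p) (X := X) (𝒢 := Gns P X γ x₀) hg
    rw [← hqopt, EReal.coe_le_coe_iff] at this
    linarith
  have hv : 0 < v := by
    by_contra! hv
    refine absurd (hp ▸ measure_mono_ae ?_) (not_le.2 hXq)
    filter_upwards [hA.ae_pricing_pos] with ω hω (h : (X ω - q) * γ (X ω) ≤ v)
    change X ω ≤ q
    by_contra! h'
    have := mul_pos (sub_pos.2 h') hω
    linarith
  -- The cost of capping vanishes at `q`, so by continuity of `γ` it stays below `v` near `q`.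
  -- Points off `B` are thus bounded away from `q`, which supplies the gap `b - q`.
  have hcont : ContinuousAt (fun x => γ x * max (x - q) 0) q :=
    (hA.continuous_pricing.continuousAt (Ioi_mem_nhds hq)).mul (by fun_prop)
  have hev : ∀ᶠ x in 𝓝 q, γ x * max (x - q) 0 < v := by
    refine hcont.eventually_lt_const ?_
    simpa using hv
  obtain ⟨ε, hε, hball⟩ := Metric.eventually_nhds_iff.1 hev
  refine not_isRobust_Gcap (U := id) hA.mem hgap hA.measurable_pricing hA.ae_pricing_pos
    hA.integrable_pricing hA.expect_pricing measurable_id hA.nonneg hA.integrable_price hp0 hp1 hq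
    hqopt hv ?_ (b := q + ε / 2) (by linarith) (Eventually.of_forall fun ω h => ?_)
  -- As `v > 0` and `γ > 0` a.s., replacing `X - q` by its positive part does not change the
  -- sublevel set at `v`.
  · rw [← hp]
    refine measure_congr ?_
    filter_upwards [hA.ae_pricing_pos] with ω hω
    refine propext ?_
    change γ (X ω) * max (X ω - q) 0 ≤ v ↔ (X ω - q) * γ (X ω) ≤ v
    rw [mul_comm (X ω - q)]
    rcases le_total 0 (X ω - q) with h | h
    · rw [max_eq_left h]
    · rw [max_eq_right h, mul_zero]
      exact iff_of_true hv.le ((mul_nonpos_of_nonneg_of_nonpos hω.le h).trans hv.le)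
  · change v < γ (X ω) * max (X ω - q) 0 at h
    change q + ε / 2 < X ω
    by_contra! hle
    rcases le_total (X ω - q) 0 with h' | h'
    · rw [max_eq_right h', mul_zero] at h
      linarith
    · refine absurd (hball (y := X ω) ?_) (not_lt.2 h.le)
      rw [Real.dist_eq, abs_of_nonneg h']
      linarith

theorem not_isRobust_Gbd (hA : StandingAssumptions P u X γ) {p : ℝ} (hp0 : 0 < p) (hp1 : p < 1)
    {m x₀ : ℝ} (hx0 : 0 ≤ x₀) (hxm : x₀ < m) (hgap : NoGap P u X)
    (hV : AssumptionV2 P p X γ x₀ m) :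
    ¬ IsRobust (VaRObj P p) (Gbd P X γ x₀ m) (u.space P) (u.dist P) X := by
  have := hA.nullSingletonClass
  intro hrob
  obtain ⟨hpos, hp⟩ := hV
  -- The optimizer supplied by the assumed robustness shows that the optimal value is a real number.
  obtain ⟨g, ⟨-, hgopt⟩, -⟩ := id hrob
  set q := VaR P p (fun ω => g (X ω)) with hqdef
  have hqopt : (q : EReal) = optimalValue (VaRObj P p) (Gbd P X γ x₀ m) X := hgopt
  have hq : 0 < q := by
    rw [← hqopt] at hpos
    exact_mod_cast hpos
  have hconst : (fun _ => x₀) ∈ Gbd P X γ x₀ m := by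
    refine ⟨⟨measurable_const, hA.integrable_pricing.mul_const _, ?_⟩,
      Eventually.of_forall fun _ => ⟨hx0, hxm.le⟩⟩
    rw [integral_mul_const, hA.expect_pricing, one_mul]
  have hqm : q < m := by
    have h1 := optimalValue_le_of_mem (P := P) (p := p) (X := X) hconst
    rw [← hqopt, EReal.coe_le_coe_iff] at h1
    refine (h1.trans (VaR_le measurable_const hp0 ?_)).trans_lt hxm
    simpa using hp1.le
  set v := VaR P p (fun ω' => γ (X ω')) with hvdef
  have hv : 0 < v := by
    by_contra! hv
    have h0 : P {ω | γ (X ω) ≤ v} = 0 := by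
      rw [← nonpos_iff_eq_zero, ← measure_empty (μ := P)]
      refine measure_mono_ae ?_
      filter_upwards [hA.ae_pricing_pos] with ω hω (h : γ (X ω) ≤ v)
      exact absurd hω (not_lt.2 (h.trans hv))
    rw [h0] at hp
    exact (ENNReal.ofReal_pos.2 hp0).ne hp
  have hmq : 0 < m - q := sub_pos.2 hqm
  -- The cost of capping is `γ (m - q)`, so the threshold for `γ` is scaled by `m - q`; any level
  -- strictly between `q` and `m` serves as `b`.
  refine not_isRobust_Gcap (U := fun _ => m) (v := v * (m - q)) hA.mem hgap hA.measurable_pricing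
    hA.ae_pricing_pos hA.integrable_pricing hA.expect_pricing measurable_const
    (Eventually.of_forall fun _ => by linarith) (hA.integrable_pricing.mul_const _) hp0 hp1 hq
    hqopt (mul_pos hv hmq) ?_ (b := (q + m) / 2) (by linarith)
    (Eventually.of_forall fun _ _ => by linarith) hrob
  rw [← hp, max_eq_left hmq.le]
  congr 1
  ext ω
  exact mul_le_mul_iff_left₀ hmq

end Standing

end RobustOpt

theorem theorem1 {Ω : Type*} [MeasurableSpace Ω] (P : MeasureTheory.Measure Ω)
    [MeasureTheory.IsProbabilityMeasure P] (u : RobustOpt.Uncertainty) (X : Ω → ℝ) (γ : ℝ → ℝ)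
    (hA : RobustOpt.StandingAssumptions P u X γ) (p : ℝ) (hp0 : 0 < p) (hp1 : p < 1) :
    (∀ x₀ : ℝ,
      RobustOpt.IsCompatible (RobustOpt.VaRObj P p) (RobustOpt.Gcm P X γ x₀)
        (u.space P) (u.dist P) ∧
      ¬ RobustOpt.IsRobust (RobustOpt.VaRObj P p) (RobustOpt.Gcm P X γ x₀)
        (u.space P) (u.dist P) X) ∧
    (∀ x₀ : ℝ, 0 ≤ x₀ → x₀ < ∫ ω, γ (X ω) * X ω ∂P → RobustOpt.NoGap P u X →
      RobustOpt.AssumptionV1 P p X γ x₀ →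
      RobustOpt.IsCompatible (RobustOpt.VaRObj P p) (RobustOpt.Gns P X γ x₀)
        (u.space P) (u.dist P) ∧
      ¬ RobustOpt.IsRobust (RobustOpt.VaRObj P p) (RobustOpt.Gns P X γ x₀)
        (u.space P) (u.dist P) X) ∧
    (∀ m x₀ : ℝ, 0 ≤ x₀ → x₀ < m → RobustOpt.NoGap P u X →
      RobustOpt.AssumptionV2 P p X γ x₀ m →
      RobustOpt.IsCompatible (RobustOpt.VaRObj P p) (RobustOpt.Gbd P X γ x₀ m)
        (u.space P) (u.dist P) ∧
      ¬ RobustOpt.IsRobust (RobustOpt.VaRObj P p) (RobustOpt.Gbd P X γ x₀ m)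
        (u.space P) (u.dist P) X) := by
  refine ⟨fun x₀ => ⟨RobustOpt.isCompatible_VaRObj fun g hg => hg.1,
      RobustOpt.not_isRobust_Gcm hA hp0 hp1 x₀⟩,
    fun x₀ _ hx₀ hgap hV => ⟨RobustOpt.isCompatible_VaRObj fun g hg => hg.1.1,
      RobustOpt.not_isRobust_Gns hA hp0 hp1 hx₀ hgap hV⟩,
    fun m x₀ hx0 hxm hgap hV => ⟨RobustOpt.isCompatible_VaRObj fun g hg => hg.1.1,
      RobustOpt.not_isRobust_Gbd hA hp0 hp1 hx0 hxm hgap hV⟩⟩
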